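/- Let $X$ be a real Banach space with topological dual $X^*$, and let $\pi(x,x^*)=\langle x,x^*\rangle=x^*(x)$ be the duality product on $X\times X^*$. For $h:X\times X^*\to[-\infty,+\infty]$ write $D(h)=\{(x,x^*): h(x,x^*)<+\infty\}$, $\mathrm{Pr}_X D(h)=\{x\in X:\exists x^*\in X^*,\ (x,x^*)\in D(h)\}$, and $$\mathcal J h(x,x^*)=h^*(x^*,x)=\sup_{(y,y^*)\in X\times X^*}\big(\langle y,x^*\rangle+\langle x,y^*\rangle-h(y,y^*)\big).$$ For a maximal monotone operator $T\subset X\times X^*$ (identified with its graph), let $\mathcal F_T$ be the family of all convex functions $g:X\times X^*\to[-\infty,+\infty]$ that are lower semicontinuous in the norm topology and satisfy $g\ge\pi$ on $X\times X^*$ and $g(x,x^*)=\langle x,x^*\rangle$ for all $(x,x^*)\in T$. Let $h:X\times X^*\to[-\infty,+\infty]$ be convex and proper (that is, $D(h)\neq\emptyset$), with $$h(x,x^*)\ge\langle x,x^*\rangle,\qquad h^*(x^*,x)\ge\langle x,x^*\rangle\qquad\text{for all }(x,x^*)\in X\times X^*.$$ Suppose that $\bigcup_{\lambda>0}\lambda\,\mathrm{Pr}_X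 D(h)$ is a closed linear subspace of $X$. Then $$T:=\{(x,x^*)\in X\times X^*: h^*(x^*,x)=\langle x,x^*\rangle\}$$ is maximal monotone, and $$\mathrm{cl}_{s\times\omega^*}h\in\mathcal F_T,$$ where $\mathrm{cl}_{s\times\omega^*}h$ is the lower semicontinuous closure of $h$ in the product of the strong (norm) topology of $X$ and the weak-star topology of $X^*$, i.e. the function whose epigraph is the closure of the epigraph of $h$ in $X\times X^*\times\mathbb R$ for that topology times the usual topology of $\mathbb R$. In particular, $\mathrm{cl}_{s\times\omega^*}h\ge\pi$. -/

import Mathlib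

open scoped Pointwise

namespace FitzpatrickFamily

noncomputable section

/-- The epigraph `E(f) ⊆ Z × ℝ` of an extended-real valued function. -/
def epigraph {Z : Type*} (f : Z → EReal) : Set (Z × ℝ) :=
  {p | f p.1 ≤ (p.2 : EReal)}

/-- The effective domain `D(f)`. -/
def effDomain {Z : Type*} (f : Z → EReal) : Set Z :=
  {z | f z < ⊤}

/-- `f` is proper: its effective domain is nonempty. -/
def IsProperFun {Z : Type*} (f : Z → EReal) : Prop :=
  (effDomain f).Nonempty

/-- Convexity of an extended-real valued function: its epigraph is convex. -/
def IsConvexFun {Z : Type*} [AddCommGroup Z] [Module ℝ Z] (f : Z → EReal) : Prop :=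
  Convex ℝ (epigraph f)

/-- The lower semicontinuous closure for the topology carried by `Z`: the function whose
epigraph is the closure of the epigraph of `f`. -/
def lscClosure {Z : Type*} [TopologicalSpace Z] (f : Z → EReal) : Z → EReal :=
  fun z => ⨅ (μ : ℝ) (_ : (z, μ) ∈ closure (epigraph f)), (μ : EReal)

/-- The Fenchel-Legendre conjugate `f^*(z^*) = sup_z (⟨z, z^*⟩ - f(z))`. -/
def fenchelConj {Z : Type*} [NormedAddCommGroup Z] [NormedSpace ℝ Z] (f : Z → EReal) :
    StrongDual ℝ Z → EReal :=
  fun z' => ⨆ z : Z, ((z' z : ℝ) : EReal) - f z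

variable {X : Type*} [NormedAddCommGroup X] [NormedSpace ℝ X]

/-- The duality product `π(x, x^*) = x^*(x)`. -/
def dualityProduct (p : X × StrongDual ℝ X) : ℝ := p.2 p.1

/-- `𝒥 h (x, x^*) = h^*(x^*, x)`, with `x` identified with its canonical image in `X^{**}`, and
`X^* × X^{**}` identified with the dual of `X × X^*` by
`⟨(y, y^*), (x^*, x^{**})⟩ = x^*(y) + x^{**}(y^*)`. -/
def conjJ (h : X × StrongDual ℝ X → EReal) : X × StrongDual ℝ X → EReal :=
  fun p => fenchelConj h
    (ContinuousLinearMap.coprod p.2 (NormedSpace.inclusionInDoubleDual ℝ X p.1))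

/-- `Pr_X D(h)`. -/
def prDomain (h : X × StrongDual ℝ X → EReal) : Set X :=
  {x | ∃ x' : StrongDual ℝ X, (x, x') ∈ effDomain h}

/-- Monotone operators `X ⇉ X^*`, identified with their graphs. -/
def IsMonotoneOp (T : Set (X × StrongDual ℝ X)) : Prop :=
  ∀ p ∈ T, ∀ q ∈ T, 0 ≤ (p.2 - q.2) (p.1 - q.1)

/-- Maximal monotone operators: maximal, for inclusion of graphs, among monotone operators. -/
def IsMaximalMonotoneOp (T : Set (X × StrongDual ℝ X)) : Prop :=
  Maximal IsMonotoneOp T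

/-- The Fitzpatrick family `𝓕_T` (lower semicontinuity is for the norm topology). -/
def fitzpatrickFamily (T : Set (X × StrongDual ℝ X)) : Set (X × StrongDual ℝ X → EReal) :=
  {h | IsConvexFun h ∧ LowerSemicontinuous h ∧
    (∀ p, (dualityProduct p : EReal) ≤ h p) ∧
    ∀ p ∈ T, h p = (dualityProduct p : EReal)}

/-- The operator `T = {(x, x^*) | h^*(x^*, x) = ⟨x, x^*⟩}`. -/
def conjOperator (h : X × StrongDual ℝ X → EReal) : Set (X × StrongDual ℝ X) :=
  {p | conjJ h p = (dualityProduct p : EReal)}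

/-- The lower semicontinuous closure of `h` in the strong × weak-star topology of `X × X^*`. -/
def swLscClosure (h : X × StrongDual ℝ X → EReal) : X × StrongDual ℝ X → EReal :=
  fun p => lscClosure
    (fun q : X × WeakDual ℝ X => h (q.1, WeakDual.toStrongDual q.2))
    (p.1, StrongDual.toWeakDual p.2)

end

end FitzpatrickFamily

open FitzpatrickFamily

namespace FitzpatrickFamily

open Set Filter Topology

variable {X : Type*} [NormedAddCommGroup X] [NormedSpace ℝ X]

/-! The argument works on the epigraph `E` of `h`, whose contact set is `T`. Baire's theorem in the
Banach space `L` shows that, near `0` in `L`, a bounded part of `E` projects densely; convexity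
spreads this to `s • x` with `s < 1`, for `x` in the closure of the projection. Over such a point
`x₀`, balancing a point of `E` against a bounded one on the opposite side of `x₀` and using `h ≥ π`
bounds `μ - x' x₀` below by `-M‖x - x₀‖`. A Hahn–Banach sandwich turns this bound into a point of
`T` over `x₀` (`exists_mem_contactSet`).

Monotonicity of `T` follows from `h* ≥ π` and convexity of `h*`. For maximality, a point
monotonically related to `T` lies over the closure of the projection, since otherwise some fibre of
`T` contains a half-line in a normal direction that violates relatedness
(`fst_mem_closure_of_related`). Contact points along segments then force it into `T`
(`mem_contactSet_of_related`).

Each point of `T` gives an affine inequality on `E` that survives strong × weak-star closure, whence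
the closure of `h` stays above `π`. Equality on `T` holds because the biconjugate is at most `π`
there, so no functional separates the contact point from the closed epigraph. -/

/-! ### A Hahn–Banach sandwich. -/

/-- A convex subset of `X × ℝ` lying above the cone `-M‖x - x₀‖` lies above an affine function
vanishing at `x₀`. -/
theorem exists_dual_le_of_neg_norm_le {S : Set (X × ℝ)} (hS : Convex ℝ S) (x₀ : X) {M : ℝ}
    (hM : 0 ≤ M) (hle : ∀ p ∈ S, -(M * ‖p.1 - x₀‖) ≤ p.2) :
    ∃ y : StrongDual ℝ X, ∀ p ∈ S, y (p.1 - x₀) ≤ p.2 := by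
  rcases S.eq_empty_or_nonempty with rfl | ⟨p₀, hp₀⟩
  · exact ⟨0, by simp⟩
  have hUc : Convex ℝ {p : X × ℝ | p.2 < -(M * ‖p.1 - x₀‖)} := by
    rintro ⟨x, r⟩ hx ⟨y, s⟩ hy a b ha hb hab
    simp only [mem_ofPred_eq, Prod.smul_mk, Prod.mk_add_mk, smul_eq_mul] at *
    have h1 : ‖a • x + b • y - x₀‖ ≤ a * ‖x - x₀‖ + b * ‖y - x₀‖ := by
      have : a • x + b • y - x₀ = a • (x - x₀) + b • (y - x₀) := by
        have : x₀ = (a + b) • x₀ := by rw [hab, one_smul]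
        nth_rewrite 1 [this]
        module
      rw [this]
      refine (norm_add_le _ _).trans ?_
      rw [norm_smul, norm_smul, Real.norm_of_nonneg ha, Real.norm_of_nonneg hb]
    have h2 := mul_le_mul_of_nonneg_left h1 hM
    rcases ha.eq_or_lt with rfl | ha
    · have : b = 1 := by linarith
      subst this
      linarith
    · have := mul_lt_mul_of_pos_left hx ha
      have := mul_le_mul_of_nonneg_left hy.le hb
      linarith
  have hUo : IsOpen {p : X × ℝ | p.2 < -(M * ‖p.1 - x₀‖)} :=
    isOpen_lt (by fun_prop) (by fun_prop)
  have hdisj : Disjoint {p : X × ℝ | p.2 < -(M * ‖p.1 - x₀‖)} S :=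
    disjoint_left.2 fun p hp hpS => absurd (hle p hpS) (not_le.2 hp)
  obtain ⟨f, u, hfU, hfS⟩ := geometric_hahn_banach_open hUc hUo hS hdisj
  set g : StrongDual ℝ X := f.comp (ContinuousLinearMap.inl ℝ X ℝ) with hg
  set c : ℝ := f (0, 1) with hc
  have hf : ∀ x r, f (x, r) = g x + r * c := by
    intro x r
    have : ((x, r) : X × ℝ) = (x, 0) + r • (0, 1) := by simp
    rw [this, map_add, map_smul]
    rfl
  have hcpos : 0 < c := by
    have h1 := hfS p₀ hp₀
    -- This point lies in the open cone and strictly below `p₀` on the same vertical line, so the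
    -- separating functional must increase upwards.
    have h2 := hfU (p₀.1, min (p₀.2 - 1) (-(M * ‖p₀.1 - x₀‖) - 1))
      (by rw [mem_ofPred_eq]; exact (min_le_right _ _).trans_lt (sub_one_lt _))
    rw [hf] at h2
    rw [← Prod.mk.eta (p := p₀), hf] at h1
    have h3 := min_le_left (p₀.2 - 1) (-(M * ‖p₀.1 - x₀‖) - 1)
    by_contra hcon
    nlinarith
  have hgx : g x₀ ≤ u := by
    refine le_of_forall_pos_le_add fun ε hε => ?_
    have h2 := hfU (x₀, -(ε / c)) (by
      have : 0 < ε / c := by positivity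
      simpa using this)
    rw [hf] at h2
    have : -(ε / c) * c = -ε := by field_simp
    linarith
  refine ⟨-(c⁻¹ • g), fun p hp => ?_⟩
  have h1 := hfS p hp
  rw [← Prod.mk.eta (p := p), hf] at h1
  have h2 : -(c⁻¹ • g) (p.1 - x₀) = c⁻¹ * (g x₀ - g p.1) := by
    simp only [smul_apply, map_sub, smul_eq_mul]
    ring
  rw [neg_apply, h2, inv_mul_le_iff₀ hcpos]
  linarith

/-! ### Epigraphs, their projections and bounded parts. -/

/-- The symmetric pairing `⟨x, y^*⟩ + ⟨y, x^*⟩` on `X × X^*`. -/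
def pairing (p q : X × StrongDual ℝ X) : ℝ := p.2 q.1 + q.2 p.1

/-- The projection on `X` of a subset of `X × X^* × ℝ`. -/
def fstProj (E : Set ((X × StrongDual ℝ X) × ℝ)) : Set X :=
  {x | ∃ x' μ, ((x, x'), μ) ∈ E}

/-- The projection on `X` of the part of `E` where the other coordinates are bounded by `N`. -/
def boundedProj (E : Set ((X × StrongDual ℝ X) × ℝ)) (N : ℝ) : Set X :=
  {x | ∃ x' μ, ‖x'‖ ≤ N ∧ μ ≤ N ∧ ((x, x'), μ) ∈ E}

/-- The points at which the conjugate of the function with epigraph `E` is at most the duality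
product. -/
def contactSet (E : Set ((X × StrongDual ℝ X) × ℝ)) : Set (X × StrongDual ℝ X) :=
  {z | ∀ q ∈ E, pairing z q.1 - q.2 ≤ dualityProduct z}

/-- `x` has a neighbourhood in `x + L` contained in the closure of some `boundedProj E N`. -/
def IsBoundedInterior (E : Set ((X × StrongDual ℝ X) × ℝ)) (L : Submodule ℝ X) (x : X) : Prop :=
  ∃ ρ : ℝ, 0 < ρ ∧ ∃ N : ℝ, ∀ w ∈ L, ‖w‖ ≤ ρ → x + w ∈ closure (boundedProj E N)

/-- The hypotheses on a convex function above the duality product, in terms of its epigraph. -/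
structure IsAdmissible (E : Set ((X × StrongDual ℝ X) × ℝ)) (L : Submodule ℝ X) : Prop where
  convex : Convex ℝ E
  upward : ∀ q ∈ E, ∀ μ, q.2 ≤ μ → (q.1, μ) ∈ E
  dualityProduct_le : ∀ q ∈ E, dualityProduct q.1 ≤ q.2
  dualityProduct_le_of_conj_le : ∀ z c, (∀ q ∈ E, pairing z q.1 - q.2 ≤ c) → dualityProduct z ≤ c
  isClosed : IsClosed (L : Set X)
  fstProj_subset : ∀ x ∈ fstProj E, x ∈ L
  absorbing : ∀ x ∈ L, ∃ c : ℝ, 0 < c ∧ c • x ∈ fstProj E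

theorem boundedProj_mono {E : Set ((X × StrongDual ℝ X) × ℝ)} {M N : ℝ} (h : M ≤ N) :
    boundedProj E M ⊆ boundedProj E N := fun _ ⟨x', μ, h1, h2, h3⟩ =>
  ⟨x', μ, h1.trans h, h2.trans h, h3⟩

theorem boundedProj_subset_fstProj (E : Set ((X × StrongDual ℝ X) × ℝ)) (N : ℝ) :
    boundedProj E N ⊆ fstProj E := fun _ ⟨x', μ, _, _, h⟩ => ⟨x', μ, h⟩

theorem exists_mem_boundedProj {E : Set ((X × StrongDual ℝ X) × ℝ)} {x : X} (hx : x ∈ fstProj E) :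
    ∃ N, x ∈ boundedProj E N := by
  obtain ⟨x', μ, h⟩ := hx
  exact ⟨max ‖x'‖ μ, x', μ, le_max_left _ _, le_max_right _ _, h⟩

theorem convex_boundedProj {E : Set ((X × StrongDual ℝ X) × ℝ)} (hE : Convex ℝ E) (N : ℝ) :
    Convex ℝ (boundedProj E N) := by
  rintro x ⟨x', μ, h1, h2, h3⟩ y ⟨y', ν, h4, h5, h6⟩ a b ha hb hab
  refine ⟨a • x' + b • y', a • μ + b • ν, ?_, ?_, hE h3 h6 ha hb hab⟩
  · exact mem_closedBall_zero_iff.1 (convex_closedBall 0 N (mem_closedBall_zero_iff.2 h1)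
      (mem_closedBall_zero_iff.2 h4) ha hb hab)
  · exact convex_Iic N h2 h5 ha hb hab

theorem convex_fstProj {E : Set ((X × StrongDual ℝ X) × ℝ)} (hE : Convex ℝ E) :
    Convex ℝ (fstProj E) := by
  rintro x ⟨x', μ, h1⟩ y ⟨y', ν, h2⟩ a b ha hb hab
  exact ⟨_, _, hE h1 h2 ha hb hab⟩

/-! ### Baire category and existence of contact points. -/

namespace IsAdmissible

variable {E : Set ((X × StrongDual ℝ X) × ℝ)} {L : Submodule ℝ X}

theorem closure_subset (hE : IsAdmissible E L) {x : X} (hx : x ∈ closure (fstProj E)) : x ∈ L :=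
  closure_minimal hE.fstProj_subset hE.isClosed hx

theorem zero_mem (hE : IsAdmissible E L) : (0 : X) ∈ fstProj E := by
  obtain ⟨c, _, h⟩ := hE.absorbing 0 L.zero_mem
  simpa using h

/-- Absorption, and convexity with `0`, make countably many closed sets `f n` cover `L`; by Baire
one contains a ball. Averaging it with a projected point in the direction opposite to its centre
moves the ball to `0`. -/
theorem isBoundedInterior_zero [CompleteSpace X] (hE : IsAdmissible E L) :
    IsBoundedInterior E L 0 := by
  have : CompleteSpace L := hE.isClosed.completeSpace_coe
  let f : ℕ → Set L := fun n => {v | ((n : ℝ) + 1)⁻¹ • (v : X) ∈ closure (boundedProj E n)}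
  have hfc : ∀ n, IsClosed (f n) := fun n =>
    isClosed_closure.preimage (by fun_prop)
  obtain ⟨N₀, hN₀⟩ := exists_mem_boundedProj hE.zero_mem
  have hfu : ⋃ n, f n = univ := by
    refine eq_univ_of_forall fun v => mem_iUnion.2 ?_
    obtain ⟨c, hc, hcv⟩ := hE.absorbing v v.2
    obtain ⟨N₁, hN₁⟩ := exists_mem_boundedProj hcv
    obtain ⟨n, hn⟩ := exists_nat_ge (max (max N₀ N₁) c⁻¹)
    have hn0 : (0 : ℝ) < (n : ℝ) + 1 := by positivity
    refine ⟨n, subset_closure ?_⟩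
    have h0 := boundedProj_mono ((le_max_left N₀ N₁).trans ((le_max_left _ _).trans hn)) hN₀
    have h1 := boundedProj_mono ((le_max_right N₀ N₁).trans ((le_max_left _ _).trans hn)) hN₁
    have hle : ((n : ℝ) + 1)⁻¹ * c⁻¹ ≤ 1 := by
      rw [inv_mul_le_iff₀ hn0]
      have := (le_max_right (max N₀ N₁) c⁻¹).trans hn
      linarith
    have := convex_boundedProj hE.convex n h1 h0 (a := ((n : ℝ) + 1)⁻¹ * c⁻¹)
      (b := 1 - ((n : ℝ) + 1)⁻¹ * c⁻¹) (by positivity) (by linarith) (by ring)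
    rwa [smul_zero, add_zero, smul_smul, mul_assoc, inv_mul_cancel₀ hc.ne', mul_one] at this
  obtain ⟨n, v₀, hv₀⟩ := nonempty_interior_of_iUnion_of_closed hfc hfu
  obtain ⟨ε, hε, hball⟩ := Metric.mem_nhds_iff.1 (mem_interior_iff_mem_nhds.1 hv₀)
  have hn0 : (0 : ℝ) < (n : ℝ) + 1 := by positivity
  set k : ℝ := ((n : ℝ) + 1)⁻¹ with hk
  have hkpos : 0 < k := by positivity
  obtain ⟨c, hc, hcv⟩ := hE.absorbing (-(k • (v₀ : X))) (L.neg_mem (L.smul_mem _ v₀.2))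
  obtain ⟨N₁, hN₁⟩ := exists_mem_boundedProj hcv
  -- The weights `θ` and `(1 + c)⁻¹` make the multiples of `v₀` cancel, since `θ = (1 + c)⁻¹ * c`.
  set θ : ℝ := c / (1 + c) with hθ
  have hθpos : 0 < θ := by positivity
  refine ⟨θ * k * (ε / 2), by positivity, max n N₁, fun w hw hwn => ?_⟩
  have h1 : k • ((v₀ : X) + (θ * k)⁻¹ • w) ∈ closure (boundedProj E n) := by
    refine @hball (v₀ + ⟨(θ * k)⁻¹ • w, L.smul_mem _ hw⟩) ?_
    rw [mem_ball_iff_norm, add_sub_cancel_left, Submodule.coe_norm, norm_smul,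
      Real.norm_of_nonneg (by positivity), inv_mul_lt_iff₀ (by positivity)]
    refine hwn.trans_lt ?_
    have : 0 < θ * k := by positivity
    nlinarith
  have h2 := closure_mono (boundedProj_mono (le_max_left (n : ℝ) N₁)) h1
  have h3 := subset_closure (boundedProj_mono (le_max_right (n : ℝ) N₁) hN₁)
  have h4 := (convex_boundedProj hE.convex (max (n : ℝ) N₁)).closure h2 h3 (a := θ)
    (b := (1 + c)⁻¹) hθpos.le (by positivity) (by rw [hθ]; field_simp; ring)
  convert h4 using 1
  rw [smul_add, smul_add, smul_smul, smul_smul, smul_smul, smul_neg, smul_neg, smul_smul, smul_smul,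
    mul_inv_cancel₀ (by positivity), one_smul, zero_add]
  have : θ * k = (1 + c)⁻¹ * c * k := by rw [hθ]; field_simp
  rw [this]
  abel

/-- Half of the scaled radius `(1 - s) * ρ` is spent on replacing `c` by a nearby point `c'` of the
projection itself. -/
theorem isBoundedInterior_combo (hE : IsAdmissible E L) {b c : X} (hb : IsBoundedInterior E L b)
    (hc : c ∈ closure (fstProj E)) {s : ℝ} (hs0 : 0 ≤ s) (hs1 : s < 1) :
    IsBoundedInterior E L ((1 - s) • b + s • c) := by
  obtain ⟨ρ, hρ, N, hN⟩ := hb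
  have h1s : 0 < 1 - s := by linarith
  obtain ⟨c', hc', hdist⟩ := Metric.mem_closure_iff.1 hc ((1 - s) * ρ / 2) (by positivity)
  obtain ⟨N₁, hN₁⟩ := exists_mem_boundedProj hc'
  have hcL : c - c' ∈ L := L.sub_mem (hE.closure_subset hc) (hE.fstProj_subset _ hc')
  refine ⟨(1 - s) * ρ / 2, by positivity, max N N₁, fun w hw hwn => ?_⟩
  have h1 := hN ((1 - s)⁻¹ • (w + s • (c - c'))) (L.smul_mem _ (L.add_mem hw (L.smul_mem _ hcL))) (by
    rw [norm_smul, Real.norm_of_nonneg (by positivity), inv_mul_le_iff₀ h1s]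
    refine (norm_add_le _ _).trans ?_
    rw [norm_smul, Real.norm_of_nonneg hs0, ← dist_eq_norm]
    have : s * dist c c' ≤ 1 * dist c c' := mul_le_mul_of_nonneg_right hs1.le dist_nonneg
    linarith)
  have h2 := closure_mono (boundedProj_mono (le_max_left N N₁)) h1
  have h3 := subset_closure (boundedProj_mono (le_max_right N N₁) hN₁)
  have h4 := (convex_boundedProj hE.convex (max N N₁)).closure h2 h3 (a := 1 - s)
    (b := s) h1s.le hs0 (by ring)
  convert h4 using 1
  rw [smul_add, smul_smul, mul_inv_cancel₀ h1s.ne', one_smul]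
  module

theorem neg_norm_le_of_isBoundedInterior (hE : IsAdmissible E L) {x₀ : X}
    (hx₀ : IsBoundedInterior E L x₀) :
    ∃ M : ℝ, 0 ≤ M ∧ ∀ q ∈ E, -(M * ‖q.1.1 - x₀‖) ≤ q.2 - q.1.2 x₀ := by
  obtain ⟨ρ, hρ, N, hN⟩ := hx₀
  have hcl : ∀ N, closure (boundedProj E N) ⊆ L := fun N x hx =>
    hE.closure_subset (closure_mono (boundedProj_subset_fstProj E N) hx)
  have hx₀L : x₀ ∈ L := by simpa using hcl N (hN 0 L.zero_mem (by simpa using hρ.le))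
  have hN0 : 0 ≤ N := by
    obtain ⟨y, x', -, h, -⟩ := closure_nonempty_iff.1 ⟨_, hN 0 L.zero_mem (by simpa using hρ.le)⟩
    exact (norm_nonneg _).trans h
  -- The numerator bounds `ν - y' x₀` for points of `E` whose dual part and height are at most `N`.
  refine ⟨N * (1 + ‖x₀‖) / ρ, by positivity, ?_⟩
  rintro ⟨⟨x, x'⟩, μ⟩ hq
  simp only
  set v := x - x₀ with hv
  have hvL : v ∈ L := L.sub_mem (hE.fstProj_subset _ ⟨x', μ, hq⟩) hx₀L
  have hxv : x = x₀ + v := by rw [hv]; abel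
  rcases eq_or_ne v 0 with hv0 | hv0
  · have := hE.dualityProduct_le _ hq
    simp only [dualityProduct] at this
    rw [hv0, norm_zero, mul_zero, neg_zero]
    rw [hxv, hv0, add_zero] at this
    linarith
  have hvpos : 0 < ‖v‖ := norm_pos_iff.2 hv0
  have hw := hN (-((ρ / ‖v‖) • v)) (L.neg_mem (L.smul_mem _ hvL)) (by
    rw [norm_neg, norm_smul, Real.norm_of_nonneg (by positivity), div_mul_cancel₀ _ hvpos.ne'])
  -- A bounded point of `E` projects within `ε` of the point at distance `ρ` from `x₀` opposite to
  -- `x`. The weights `‖v‖ / (‖v‖ + ρ)` and `ρ / (‖v‖ + ρ)` put the convex combination over `x₀` up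
  -- to a small error, where `h ≥ π` applies.
  have key : ∀ ε > 0, -(N * (1 + ‖x₀‖) * ‖v‖) ≤ ρ * (μ - x' x₀)
      + ε * ((‖v‖ * N + ρ * ‖x'‖) * (‖v‖ / (‖v‖ + ρ))) := by
    intro ε hε
    obtain ⟨y, ⟨y', ν, hy1, hy2, hy3⟩, hyd⟩ := Metric.mem_closure_iff.1 hw ε hε
    obtain ⟨e, he⟩ : ∃ e, e = y - (x₀ + -((ρ / ‖v‖) • v)) := ⟨_, rfl⟩
    have hen : ‖e‖ ≤ ε := by rw [he, ← dist_eq_norm, dist_comm]; exact hyd.le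
    have hsum : 0 < ‖v‖ + ρ := by positivity
    have h1 := hE.dualityProduct_le _ (hE.convex hy3 hq (a := ‖v‖ / (‖v‖ + ρ))
      (b := ρ / (‖v‖ + ρ)) (by positivity) (by positivity) (by field_simp))
    have hpt : (‖v‖ / (‖v‖ + ρ)) • y + (ρ / (‖v‖ + ρ)) • x = x₀ + (‖v‖ / (‖v‖ + ρ)) • e := by
      have h2 : y = e + (x₀ - (ρ / ‖v‖) • v) := by rw [he]; abel
      rw [h2, hxv]
      have h3 : ‖v‖ / (‖v‖ + ρ) * (ρ / ‖v‖) = ρ / (‖v‖ + ρ) := by field_simp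
      have h4 : ‖v‖ / (‖v‖ + ρ) = 1 - ρ / (‖v‖ + ρ) := by field_simp; ring
      rw [smul_add, smul_sub, smul_smul, h3, h4]
      module
    simp only [dualityProduct, Prod.smul_mk, Prod.mk_add_mk] at h1
    rw [hpt] at h1
    simp only [smul_eq_mul] at h1
    set t := ‖v‖ / (‖v‖ + ρ) with ht
    have ht0 : 0 ≤ t := by positivity
    have h5 : ((t • y' + (ρ / (‖v‖ + ρ)) • x') (x₀ + t • e)) * (‖v‖ + ρ)
        = ‖v‖ * y' x₀ + ρ * x' x₀ + t * (‖v‖ * y' e + ρ * x' e) := by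
      simp only [add_apply, smul_apply, map_add, map_smul,
        smul_eq_mul]
      have : t * (‖v‖ + ρ) = ‖v‖ := by rw [ht]; field_simp
      have : ρ / (‖v‖ + ρ) * (‖v‖ + ρ) = ρ := by field_simp
      linear_combination (y' x₀ + t * y' e) * ‹t * (‖v‖ + ρ) = ‖v‖› + (x' x₀ + t * x' e) * this
    have h6 : (t * ν + ρ / (‖v‖ + ρ) * μ) * (‖v‖ + ρ) = ‖v‖ * ν + ρ * μ := by
      rw [ht]; field_simp
    have h7 := mul_le_mul_of_nonneg_right h1 hsum.le
    rw [h5, h6] at h7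
    have h8 : -(N * ‖x₀‖) ≤ y' x₀ := by
      have := (abs_le.1 (y'.le_of_opNorm_le hy1 x₀)).1
      exact this
    have h9 : -(N * ε) ≤ y' e := by
      have := (abs_le.1 (y'.le_of_opNorm_le hy1 e)).1
      nlinarith
    have h10 : -(‖x'‖ * ε) ≤ x' e := by
      have := (abs_le.1 (x'.le_opNorm e)).1
      nlinarith [norm_nonneg x']
    have h11 : -(ε * (‖v‖ * N + ρ * ‖x'‖)) ≤ ‖v‖ * y' e + ρ * x' e := by
      nlinarith
    have h12 := mul_le_mul_of_nonneg_left h11 ht0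
    have h13 := mul_le_mul_of_nonneg_left h8 hvpos.le
    have h14 := mul_le_mul_of_nonneg_left hy2 hvpos.le
    linarith
  have hlim : -(N * (1 + ‖x₀‖) * ‖v‖) ≤ ρ * (μ - x' x₀) := by
    refine le_of_forall_pos_le_add fun δ hδ => ?_
    set K := (‖v‖ * N + ρ * ‖x'‖) * (‖v‖ / (‖v‖ + ρ)) with hK
    have hK0 : 0 ≤ K := by positivity
    have h1 := key (δ / (K + 1)) (by positivity)
    have h2 : δ / (K + 1) * K ≤ δ := by
      rw [div_mul_eq_mul_div, div_le_iff₀ (by positivity)]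
      nlinarith
    linarith
  have : N * (1 + ‖x₀‖) / ρ * ‖v‖ = N * (1 + ‖x₀‖) * ‖v‖ / ρ := by ring
  rw [this, ← neg_div, div_le_iff₀ hρ]
  linarith

/-- A bound from below on the slopes at `x₀` yields a point of the contact set over `x₀`. -/
theorem exists_mem_contactSet_of_neg_norm_le (hE : IsAdmissible E L) {x₀ : X} {M : ℝ} (hM : 0 ≤ M)
    (hle : ∀ q ∈ E, -(M * ‖q.1.1 - x₀‖) ≤ q.2 - q.1.2 x₀) : ∃ y, (x₀, y) ∈ contactSet E := by
  have hconv : Convex ℝ ((fun q : (X × StrongDual ℝ X) × ℝ => (q.1.1, q.2 - q.1.2 x₀)) '' E) := by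
    refine hE.convex.is_linear_image ⟨fun p q => ?_, fun c p => ?_⟩
    · ext <;> simp; ring
    · ext <;> simp; ring
  obtain ⟨y, hy⟩ := exists_dual_le_of_neg_norm_le hconv x₀ hM (by
    rintro _ ⟨q, hq, rfl⟩
    exact hle q hq)
  refine ⟨y, fun q hq => ?_⟩
  have := hy _ ⟨q, hq, rfl⟩
  simp only [map_sub] at this
  simp only [pairing, dualityProduct]
  linarith

theorem exists_mem_contactSet (hE : IsAdmissible E L) {x₀ : X} (hx₀ : IsBoundedInterior E L x₀) :
    ∃ y, (x₀, y) ∈ contactSet E :=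
  let ⟨_, hM, hle⟩ := hE.neg_norm_le_of_isBoundedInterior hx₀
  hE.exists_mem_contactSet_of_neg_norm_le hM hle

end IsAdmissible

/-! ### Maximal monotonicity of the contact set. -/

theorem le_at_one_of_forall_Ico {f g : ℝ → ℝ} (hf : Continuous f) (hg : Continuous g)
    (h : ∀ s, 0 ≤ s → s < 1 → f s ≤ g s) : f 1 ≤ g 1 := by
  have h1 : closure (Ico (0 : ℝ) 1) ⊆ {s | f s ≤ g s} :=
    closure_minimal (fun s hs => h s hs.1 hs.2) (isClosed_le hf hg)
  rw [closure_Ico zero_ne_one] at h1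
  exact h1 (right_mem_Icc.2 zero_le_one)

namespace IsAdmissible

variable {E : Set ((X × StrongDual ℝ X) × ℝ)} {L : Submodule ℝ X}

theorem isBoundedInterior_smul [CompleteSpace X] (hE : IsAdmissible E L) {x : X}
    (hx : x ∈ closure (fstProj E)) {s : ℝ} (hs0 : 0 ≤ s) (hs1 : s < 1) :
    IsBoundedInterior E L (s • x) := by
  simpa using hE.isBoundedInterior_combo hE.isBoundedInterior_zero hx hs0 hs1

theorem isMonotoneOp_contactSet (hE : IsAdmissible E L) : IsMonotoneOp (contactSet E) := by
  intro p hp q hq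
  have h := hE.dualityProduct_le_of_conj_le ((1 / 2 : ℝ) • (p + q))
    ((dualityProduct p + dualityProduct q) / 2) fun r hr => by
      have h1 := hp r hr
      have h2 := hq r hr
      simp only [pairing, Prod.smul_fst, Prod.smul_snd, Prod.fst_add, Prod.snd_add, add_apply,
        smul_apply, map_smul, map_add, smul_eq_mul] at *
      linarith
  simp only [dualityProduct, Prod.smul_fst, Prod.smul_snd, Prod.fst_add, Prod.snd_add, add_apply,
    smul_apply, map_smul, map_add, smul_eq_mul, sub_apply, map_sub] at *
  linarith

/-- On the contact set the biconjugate is at most the duality product. -/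
theorem pairing_le_of_mem_contactSet (hE : IsAdmissible E L) {z p : X × StrongDual ℝ X}
    (hz : z ∈ contactSet E) {c : ℝ} (hc : ∀ q ∈ E, pairing p q.1 - q.2 ≤ c) :
    pairing z p ≤ dualityProduct z + c := by
  have h : ∀ s : ℝ, 0 ≤ s → s < 1 →
      s * pairing z p ≤ s * dualityProduct z + c - (1 - s) * dualityProduct p := by
    intro s hs0 hs1
    have h := hE.dualityProduct_le_of_conj_le (s • z + (1 - s) • p)
      (s * dualityProduct z + (1 - s) * c) fun r hr => by
        have h1 := mul_le_mul_of_nonneg_left (hz r hr) hs0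
        have h2 := mul_le_mul_of_nonneg_left (hc r hr) (sub_nonneg.2 hs1.le)
        simp only [pairing, Prod.smul_fst, Prod.smul_snd, Prod.fst_add, Prod.snd_add, add_apply,
          smul_apply, map_smul, map_add, smul_eq_mul] at *
        linarith
    -- Expanding `π` at the convex combination leaves a common factor `1 - s`; dividing by it and
    -- letting `s` tend to `1` differentiates at `z`.
    have h3 : (1 - s) * (s * pairing z p) ≤
        (1 - s) * (s * dualityProduct z + c - (1 - s) * dualityProduct p) := by
      simp only [pairing, dualityProduct, Prod.smul_fst, Prod.smul_snd, Prod.fst_add, Prod.snd_add,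
        add_apply, smul_apply, map_smul, map_add, smul_eq_mul] at *
      linarith
    exact le_of_mul_le_mul_left h3 (sub_pos.2 hs1)
  have := le_at_one_of_forall_Ico (f := fun s => s * pairing z p)
    (g := fun s => s * dualityProduct z + c - (1 - s) * dualityProduct p)
    (by fun_prop) (by fun_prop) h
  simpa using this

theorem mem_contactSet_of_related [CompleteSpace X] (hE : IsAdmissible E L)
    {z : X × StrongDual ℝ X} (hz : ∀ p ∈ contactSet E, 0 ≤ (z.2 - p.2) (z.1 - p.1))
    (hcl : z.1 ∈ closure (fstProj E)) : z ∈ contactSet E := by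
  obtain ⟨x₀, z'⟩ := z
  simp only at hz hcl
  intro q hq
  obtain ⟨v, ν, hv⟩ := hE.zero_mem
  have main : ∀ x x' μ, ((x, x'), μ) ∈ E → IsBoundedInterior E L x →
      pairing (x₀, z') (x, x') - μ ≤ dualityProduct (x₀, z') := by
    intro x x' μ hx hxB
    have h : ∀ s : ℝ, 0 ≤ s → s < 1 → (1 - s) * x' x + s * x' x₀ - μ ≤ s * (z' x₀ - z' x) := by
      intro s hs0 hs1
      -- The unknown `y` enters only through `y (x₀ - x)`: the contact inequality bounds this below
      -- and relatedness bounds it above by `z' (x₀ - x)`.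
      obtain ⟨y, hy⟩ := hE.exists_mem_contactSet (hE.isBoundedInterior_combo hxB hcl hs0 hs1)
      have h1 := hy _ hx
      have h2 := hz _ hy
      have h3 : x₀ - ((1 - s) • x + s • x₀) = (1 - s) • (x₀ - x) := by module
      rw [h3, map_smul, smul_eq_mul] at h2
      have h4 := nonneg_of_mul_nonneg_right h2 (sub_pos.2 hs1)
      simp only [pairing, dualityProduct, map_add, map_smul, smul_eq_mul, map_sub, sub_apply] at *
      nlinarith
    have := le_at_one_of_forall_Ico (f := fun s => (1 - s) * x' x + s * x' x₀ - μ)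
      (g := fun s => s * (z' x₀ - z' x)) (by fun_prop) (by fun_prop) h
    simp only [pairing, dualityProduct] at *
    linarith
  have h : ∀ s : ℝ, 0 ≤ s → s < 1 → s * (pairing (x₀, z') q.1 - q.2) +
      (1 - s) * (pairing (x₀, z') (0, v) - ν) ≤ dualityProduct (x₀, z') := by
    intro s hs0 hs1
    have h1 := hE.convex hq hv hs0 (sub_nonneg.2 hs1.le) (by ring)
    have h2 := main _ _ _ h1 (by
      simpa using hE.isBoundedInterior_smul (subset_closure ⟨_, _, hq⟩) hs0 hs1)
    simp only [pairing, Prod.smul_fst, Prod.smul_snd, add_apply,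
      smul_apply, map_smul, map_add, smul_eq_mul] at *
    linarith
  have := le_at_one_of_forall_Ico (f := fun s => s * (pairing (x₀, z') q.1 - q.2) +
      (1 - s) * (pairing (x₀, z') (0, v) - ν)) (g := fun _ => dualityProduct (x₀, z'))
      (by fun_prop) (by fun_prop) h
  simpa using this

/-- Fibres of the contact set are invariant under adding functionals that vanish on `L`; if `z.1 ∉
L`, such a functional nonzero at `z.1` breaks relatedness. -/
theorem fst_mem_of_related [CompleteSpace X] (hE : IsAdmissible E L)
    {z : X × StrongDual ℝ X} (hz : ∀ p ∈ contactSet E, 0 ≤ (z.2 - p.2) (z.1 - p.1)) :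
    z.1 ∈ L := by
  by_contra hL
  obtain ⟨u, r, hu, hr⟩ := geometric_hahn_banach_closed_point L.convex hE.isClosed hL
  have hr0 : 0 < r := by simpa using hu 0 L.zero_mem
  have hu0 : ∀ a ∈ L, u a = 0 := by
    intro a ha
    by_contra hne
    have := hu ((r / u a) • a) (L.smul_mem _ ha)
    rw [map_smul, smul_eq_mul, div_mul_cancel₀ _ hne] at this
    exact this.false
  obtain ⟨y, hy⟩ := hE.exists_mem_contactSet hE.isBoundedInterior_zero
  have hyt : ∀ t : ℝ, ((0 : X), y + t • u) ∈ contactSet E := by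
    intro t q hq
    have h1 := hy q hq
    have h2 := hu0 q.1.1 (hE.fstProj_subset _ ⟨_, _, hq⟩)
    simpa [pairing, dualityProduct, h2] using h1
  -- This multiple of `u` makes the monotonicity pairing equal to `-1`.
  have h := hz _ (hyt ((z.2 z.1 - y z.1 + 1) / u z.1))
  simp only [sub_zero, sub_apply, add_apply, smul_apply, smul_eq_mul,
    div_mul_cancel₀ _ (hr0.trans hr).ne'] at h
  linarith

/-- Otherwise the ray to `z.1` leaves the closed projection at some `s₀ • x₀` with `s₀ < 1`.
Relatedness keeps the slope bounds uniform up to `s₀`, so there is a contact point over this exit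
point. Adding large multiples of a normal functional `u` with `u x₀ > 0` stays in the contact set
but contradicts relatedness. -/
theorem fst_mem_closure_of_related [CompleteSpace X] (hE : IsAdmissible E L)
    {z : X × StrongDual ℝ X} (hz : ∀ p ∈ contactSet E, 0 ≤ (z.2 - p.2) (z.1 - p.1)) :
    z.1 ∈ closure (fstProj E) := by
  by_contra hcl
  have hL := hE.fst_mem_of_related hz
  obtain ⟨x₀, z'⟩ := z
  simp only at hz hcl hL
  have hC := (convex_fstProj hE.convex).closure
  have h0C : (0 : X) ∈ closure (fstProj E) := subset_closure hE.zero_mem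
  obtain ⟨ρ, hρ, N, hN⟩ := hE.isBoundedInterior_zero
  simp only [zero_add] at hN
  have hNcl : ∀ w ∈ L, ‖w‖ ≤ ρ → w ∈ closure (fstProj E) := fun w hw hwn =>
    closure_mono (boundedProj_subset_fstProj E N) (hN w hw hwn)
  have hN0 : 0 ≤ N := by
    obtain ⟨y, x', -, h, -⟩ := closure_nonempty_iff.1 ⟨_, hN 0 L.zero_mem (by simpa using hρ.le)⟩
    exact (norm_nonneg _).trans h
  have hx₀ : 0 < ‖x₀‖ := norm_pos_iff.2 fun h => hcl (h ▸ h0C)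
  have hScpt : IsCompact (Icc (0 : ℝ) 1 ∩ {s | s • x₀ ∈ closure (fstProj E)}) :=
    isCompact_Icc.inter_right (isClosed_closure.preimage (by fun_prop))
  obtain ⟨s₀, ⟨⟨hs₀0, hs₀1⟩, hs₀C⟩, hs₀max⟩ := hScpt.exists_isGreatest
    ⟨0, left_mem_Icc.2 zero_le_one, by simpa using h0C⟩
  simp only [mem_ofPred_eq] at hs₀C
  have hmax : ∀ s : ℝ, 0 ≤ s → s • x₀ ∈ closure (fstProj E) → s ≤ s₀ := by
    intro s hs hsC
    rcases le_or_gt s 1 with h1 | h1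
    · exact hs₀max ⟨⟨hs, h1⟩, hsC⟩
    · refine absurd ?_ hcl
      have := hC hsC h0C (a := s⁻¹) (b := 1 - s⁻¹) (by positivity)
        (sub_nonneg.2 (inv_le_one_of_one_le₀ h1.le)) (by ring)
      rwa [smul_zero, add_zero, smul_smul, inv_mul_cancel₀ (by positivity), one_smul] at this
  have hs₀lt : s₀ < 1 := lt_of_le_of_ne hs₀1 fun h => hcl (by simpa [h] using hs₀C)
  have hs₀pos : 0 < s₀ := by
    refine lt_of_lt_of_le (div_pos hρ hx₀) (hmax _ (by positivity) (hNcl _ (L.smul_mem _ hL) ?_))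
    rw [norm_smul, Real.norm_of_nonneg (by positivity), div_mul_cancel₀ _ hx₀.ne']
  set Q : ℝ := |z' x₀| + N * ‖x₀‖ + N with hQ
  have hQ0 : 0 ≤ Q := by positivity
  -- The constant `Q / ρ` does not depend on `s`, which permits the passage to `s₀`.
  have hslope : ∀ s : ℝ, 0 ≤ s → s < s₀ → ∀ q ∈ E,
      -(Q / ρ * ‖q.1.1 - s • x₀‖) ≤ q.2 - s * q.1.2 x₀ := by
    intro s hs hss₀ q hq
    have hB : IsBoundedInterior E L (s • x₀) := by
      have := hE.isBoundedInterior_smul hs₀C (s := s / s₀) (by positivity)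
        ((div_lt_one hs₀pos).2 hss₀)
      rwa [smul_smul, div_mul_cancel₀ _ hs₀pos.ne'] at this
    obtain ⟨y, hy⟩ := hE.exists_mem_contactSet hB
    have hyx : y x₀ ≤ z' x₀ := by
      have h1 := hz _ hy
      have h2 : x₀ - s • x₀ = (1 - s) • x₀ := by module
      simp only [h2, map_smul, smul_eq_mul] at h1
      have := nonneg_of_mul_nonneg_right h1 (by linarith)
      rw [sub_apply] at this
      linarith
    have hsy : s * y x₀ ≤ |z' x₀| := by
      have h1 := mul_le_mul_of_nonneg_left (hyx.trans (le_abs_self _)) hs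
      have h2 := mul_le_mul_of_nonneg_right (hss₀.le.trans hs₀1) (abs_nonneg (z' x₀))
      linarith
    have hbd : closure (boundedProj E N) ⊆ {w | y w ≤ Q} := by
      refine closure_minimal ?_ (isClosed_le (by fun_prop) (by fun_prop))
      rintro w ⟨w', μ, hw', hμ, hw⟩
      have h1 := hy _ hw
      have h2 := (abs_le.1 (w'.le_of_opNorm_le hw' x₀)).1
      simp only [pairing, dualityProduct, map_smul, smul_eq_mul] at h1
      have h3 := mul_le_mul_of_nonneg_left h2 hs
      have h4 : s * (N * ‖x₀‖) ≤ 1 * (N * ‖x₀‖) :=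
        mul_le_mul_of_nonneg_right (hss₀.le.trans hs₀1) (by positivity)
      simp only [mem_ofPred_eq]
      linarith
    have hyv : ∀ v ∈ L, -(Q / ρ * ‖v‖) ≤ y v := by
      intro v hv
      rcases eq_or_ne v 0 with rfl | hv0
      · simp
      have hvpos : 0 < ‖v‖ := norm_pos_iff.2 hv0
      have h1 := hbd (hN (-((ρ / ‖v‖) • v)) (L.neg_mem (L.smul_mem _ hv)) (by
        rw [norm_neg, norm_smul, Real.norm_of_nonneg (by positivity),
          div_mul_cancel₀ _ hvpos.ne']))
      simp only [mem_ofPred_eq, map_neg, map_smul, smul_eq_mul] at h1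
      have h2 := mul_le_mul_of_nonneg_left h1 (show 0 ≤ ‖v‖ / ρ by positivity)
      have h3 : ‖v‖ / ρ * -(ρ / ‖v‖ * y v) = -y v := by field_simp
      have h4 : ‖v‖ / ρ * Q = Q / ρ * ‖v‖ := by ring
      linarith
    have h1 := hy q hq
    have h2 := hyv (q.1.1 - s • x₀) (L.sub_mem (hE.fstProj_subset _ ⟨_, _, hq⟩) (L.smul_mem _ hL))
    simp only [pairing, dualityProduct, map_smul, smul_eq_mul, map_sub] at h1 h2
    linarith
  obtain ⟨y, hy⟩ := hE.exists_mem_contactSet_of_neg_norm_le (x₀ := s₀ • x₀) (M := Q / ρ)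
    (by positivity) fun q hq => by
      have := le_at_one_of_forall_Ico (f := fun s => -(Q / ρ * ‖q.1.1 - (s * s₀) • x₀‖))
        (g := fun s => q.2 - (s * s₀) * q.1.2 x₀) (by fun_prop) (by fun_prop)
        fun s hs0 hs1 => hslope (s * s₀) (by positivity) (by nlinarith) q hq
      simpa using this
  -- A functional below this set, vanishing at `s₀ • x₀`, is normal to the projection there (take `t
  -- = 0`) and positive at `x₀` (take `x = 0`, `t = 1`).
  have hSconv : Convex ℝ {p : X × ℝ | ∃ x ∈ fstProj E, ∃ t : ℝ, 0 ≤ t ∧ p = (x - t • x₀, -t)} := by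
    rintro _ ⟨x, hx, t, ht, rfl⟩ _ ⟨w, hw, r, hr, rfl⟩ a b ha hb hab
    refine ⟨a • x + b • w, convex_fstProj hE.convex hx hw ha hb hab, a * t + b * r,
      by positivity, ?_⟩
    ext
    · simp only [Prod.fst_add, Prod.smul_fst]
      module
    · simp only [Prod.snd_add, Prod.smul_snd, smul_eq_mul]
      ring
  obtain ⟨u, hu⟩ := exists_dual_le_of_neg_norm_le hSconv (s₀ • x₀) (M := s₀ / ρ) (by positivity) (by
    rintro _ ⟨x, hx, t, ht, rfl⟩
    simp only
    set d := ‖x - t • x₀ - s₀ • x₀‖ with hd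
    set e := -(x - t • x₀ - s₀ • x₀) with he
    have heL : e ∈ L := L.neg_mem (L.sub_mem (L.sub_mem (hE.fstProj_subset _ hx)
      (L.smul_mem _ hL)) (L.smul_mem _ hL))
    have hen : ‖e‖ = d := norm_neg _
    have hd0 : 0 ≤ d := norm_nonneg _
    have hwd : d • ((ρ / d) • e) = ρ • e := by
      rcases eq_or_ne d 0 with h0 | h0
      · have : e = 0 := norm_eq_zero.1 (hen.trans h0)
        simp [this]
      · rw [smul_smul, mul_div_cancel₀ _ h0]
    have hwn : ‖(ρ / d) • e‖ ≤ ρ := by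
      rw [norm_smul, Real.norm_of_nonneg (by positivity), hen]
      rcases eq_or_ne d 0 with h0 | h0
      · simpa [h0] using hρ.le
      · rw [div_mul_cancel₀ _ h0]
    have h1 := hC (subset_closure hx) (hNcl _ (L.smul_mem (ρ / d) heL) hwn) (a := ρ / (ρ + d))
      (b := d / (ρ + d)) (by positivity) (by positivity) (by field_simp)
    -- The ball vector points along `e`, so the combination lands on the ray; maximality of `s₀`
    -- then gives `t ≤ s₀ / ρ * d`.
    have h2 : (ρ / (ρ + d)) • x + (d / (ρ + d)) • (ρ / d) • e =
        (ρ * (s₀ + t) / (ρ + d)) • x₀ := by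
      have h3 : (d / (ρ + d)) • (ρ / d) • e = (ρ + d)⁻¹ • d • (ρ / d) • e := by
        rw [smul_smul (ρ + d)⁻¹, div_eq_inv_mul]
      rw [h3, hwd, he, div_eq_inv_mul, div_eq_inv_mul]
      module
    rw [h2] at h1
    have h4 := hmax _ (by positivity) h1
    rw [div_le_iff₀ (by positivity)] at h4
    rw [neg_le_neg_iff, div_mul_eq_mul_div, le_div_iff₀ hρ]
    linarith)
  have hu1 : ∀ x ∈ fstProj E, u x ≤ s₀ * u x₀ := by
    intro x hx
    have := hu _ ⟨x, hx, 0, le_rfl, rfl⟩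
    simp only [zero_smul, sub_zero, map_sub, map_smul, smul_eq_mul, neg_zero] at this
    linarith
  have hu2 : 0 < u x₀ := by
    have := hu _ ⟨0, hE.zero_mem, 1, zero_le_one, rfl⟩
    simp only [one_smul, zero_sub, map_sub, map_neg, map_smul, smul_eq_mul] at this
    by_contra hcon
    nlinarith
  have hyt : ∀ t : ℝ, 0 ≤ t → (s₀ • x₀, y + t • u) ∈ contactSet E := by
    intro t ht q hq
    have h1 := hy q hq
    have h2 := mul_le_mul_of_nonneg_left (hu1 q.1.1 ⟨_, _, hq⟩) ht
    simp only [pairing, dualityProduct, map_smul, add_apply, smul_apply, smul_eq_mul] at *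
    linarith
  have h1 := hz _ (hyt ((|z' x₀ - y x₀| + 1) / u x₀) (by positivity))
  have h2 : x₀ - s₀ • x₀ = (1 - s₀) • x₀ := by module
  simp only [h2, map_smul, smul_eq_mul] at h1
  have h3 := nonneg_of_mul_nonneg_right h1 (sub_pos.2 hs₀lt)
  simp only [sub_apply, add_apply, smul_apply, smul_eq_mul, div_mul_cancel₀ _ hu2.ne'] at h3
  have := le_abs_self (z' x₀ - y x₀)
  linarith

theorem isMaximalMonotoneOp_contactSet [CompleteSpace X] (hE : IsAdmissible E L) :
    IsMaximalMonotoneOp (contactSet E) := by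
  refine ⟨hE.isMonotoneOp_contactSet, fun S hS hle z hz => ?_⟩
  have hrel : ∀ p ∈ contactSet E, 0 ≤ (z.2 - p.2) (z.1 - p.1) := fun p hp => hS z hz p (hle hp)
  exact hE.mem_contactSet_of_related hrel (hE.fst_mem_closure_of_related hrel)

end IsAdmissible

/-! ### The strong × weak-star closure of the epigraph. -/

/-- A subset of `X × X^* × ℝ` regarded as a subset of `X × X^* × ℝ` with the strong × weak-star
topology. -/
def weakStarSet (E : Set ((X × StrongDual ℝ X) × ℝ)) : Set ((X × WeakDual ℝ X) × ℝ) :=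
  {p | ((p.1.1, WeakDual.toStrongDual p.1.2), p.2) ∈ E}

theorem convex_weakStarSet {E : Set ((X × StrongDual ℝ X) × ℝ)} (hE : Convex ℝ E) :
    Convex ℝ (weakStarSet E) := fun _ hp _ hq _ _ ha hb hab => hE hp hq ha hb hab

/-- Weak-star continuous functionals are evaluations. -/
theorem exists_eval_of_weakDual (f : WeakDual ℝ X →L[ℝ] ℝ) : ∃ a : X, ∀ w, f w = w a := by
  obtain ⟨a, ha⟩ := LinearMap.dualEmbedding_surjective (topDualPairing ℝ X) f
  exact ⟨a, fun w => by rw [← ha]; rfl⟩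

namespace IsAdmissible

variable {E : Set ((X × StrongDual ℝ X) × ℝ)} {L : Submodule ℝ X}

theorem pairing_le_of_mem_closure {z : X × StrongDual ℝ X} (hz : z ∈ contactSet E)
    {p : (X × WeakDual ℝ X) × ℝ} (hp : p ∈ closure (weakStarSet E)) :
    z.2 p.1.1 + p.1.2 z.1 - p.2 ≤ dualityProduct z := by
  have hcont : Continuous fun p : (X × WeakDual ℝ X) × ℝ => z.2 p.1.1 + p.1.2 z.1 - p.2 := by
    have h1 : Continuous fun p : (X × WeakDual ℝ X) × ℝ => p.1.2 z.1 :=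
      (WeakDual.eval_continuous z.1).comp (continuous_snd.comp continuous_fst)
    fun_prop
  exact closure_minimal (t := {p : (X × WeakDual ℝ X) × ℝ |
    z.2 p.1.1 + p.1.2 z.1 - p.2 ≤ dualityProduct z}) (fun q hq => hz _ hq)
    (isClosed_le hcont continuous_const) hp

/-- The pairing is not jointly continuous for this topology, so contact inequalities replace it.
Mixing `p` with a point of `E` over `0` moves its base to `s • p.1.1`, where a contact point `y`
exists; the terms in `y` cancel and `s` tends to `1`. -/
theorem dualityProduct_le_of_mem_closure [CompleteSpace X] (hE : IsAdmissible E L)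
    {p : (X × WeakDual ℝ X) × ℝ} (hp : p ∈ closure (weakStarSet E)) : p.1.2 p.1.1 ≤ p.2 := by
  have hcl : p.1.1 ∈ closure (fstProj E) :=
    map_mem_closure (f := fun p : (X × WeakDual ℝ X) × ℝ => p.1.1) (by fun_prop) hp
      fun q hq => ⟨_, _, hq⟩
  obtain ⟨v, ν, hv⟩ := hE.zero_mem
  have hv' : (((0 : X), StrongDual.toWeakDual v), ν) ∈ closure (weakStarSet E) :=
    subset_closure hv
  have h : ∀ s : ℝ, 0 ≤ s → s < 1 →
      s * (s * p.1.2 p.1.1 + (1 - s) * v p.1.1) ≤ s * p.2 + (1 - s) * ν := by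
    intro s hs0 hs1
    obtain ⟨y, hy⟩ := hE.exists_mem_contactSet (hE.isBoundedInterior_smul hcl hs0 hs1)
    have h1 := (convex_weakStarSet hE.convex).closure hp hv' hs0 (sub_nonneg.2 hs1.le) (by ring)
    have h2 := pairing_le_of_mem_closure hy h1
    have h3 : (s • p.1.2 + (1 - s) • StrongDual.toWeakDual v) (s • p.1.1) =
        s * (s * p.1.2 p.1.1 + (1 - s) * v p.1.1) := by
      change s * p.1.2 (s • p.1.1) + (1 - s) * v (s • p.1.1) = _
      rw [map_smul, map_smul, smul_eq_mul, smul_eq_mul]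
      ring
    simp only [Prod.smul_fst, Prod.smul_snd, Prod.fst_add, Prod.snd_add, smul_zero, add_zero,
      dualityProduct, smul_eq_mul] at h2
    rw [h3] at h2
    linarith
  have := le_at_one_of_forall_Ico
    (f := fun s => s * (s * p.1.2 p.1.1 + (1 - s) * v p.1.1))
    (g := fun s => s * p.2 + (1 - s) * ν) (by fun_prop) (by fun_prop) h
  simpa using this

/-- A separating functional would bound the conjugate of `h` at one point too strongly, against the
biconjugate bound `pairing_le_of_mem_contactSet`. -/
theorem mem_closure_of_mem_contactSet (hE : IsAdmissible E L) {z : X × StrongDual ℝ X}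
    (hz : z ∈ contactSet E) :
    ((z.1, StrongDual.toWeakDual z.2), dualityProduct z) ∈ closure (weakStarSet E) := by
  have : LocallyConvexSpace ℝ (WeakDual ℝ X) :=
    inferInstanceAs (LocallyConvexSpace ℝ (WeakBilin (topDualPairing ℝ X)))
  by_contra hcon
  obtain ⟨f, u, hfz, hf⟩ := geometric_hahn_banach_point_closed
    (convex_weakStarSet hE.convex).closure isClosed_closure hcon
  obtain ⟨a, ha⟩ := exists_eval_of_weakDual
    (f.comp ((ContinuousLinearMap.inl ℝ (X × WeakDual ℝ X) ℝ).comp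
      (ContinuousLinearMap.inr ℝ X (WeakDual ℝ X))))
  set g : StrongDual ℝ X := f.comp ((ContinuousLinearMap.inl ℝ (X × WeakDual ℝ X) ℝ).comp
      (ContinuousLinearMap.inl ℝ X (WeakDual ℝ X))) with hg
  set r : ℝ := f (0, 1) with hr
  have hfx : ∀ x (w : StrongDual ℝ X) μ,
      f ((x, StrongDual.toWeakDual w), μ) = g x + w a + μ * r := by
    intro x w μ
    have h1 : (((x, StrongDual.toWeakDual w), μ) : (X × WeakDual ℝ X) × ℝ) =
        ((x, 0), 0) + ((0, StrongDual.toWeakDual w), 0) + μ • (0, 1) := by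
      ext <;> simp
    rw [h1, map_add, map_add, map_smul]
    have h2 := ha (StrongDual.toWeakDual w)
    change f ((0, StrongDual.toWeakDual w), 0) = w a at h2
    rw [h2]
    rfl
  have hfE : ∀ q ∈ E, u < g q.1.1 + q.1.2 a + q.2 * r := fun q hq => by
    rw [← hfx]
    exact hf _ (subset_closure hq)
  rw [hfx] at hfz
  obtain ⟨v, ν, hv⟩ := hE.zero_mem
  have hr0 : 0 ≤ r := by
    by_contra hneg
    push Not at hneg
    have h1 := hfE _ (hE.upward _ hv (max ν ((u - v a) / r)) (le_max_left _ _))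
    simp only [map_zero, zero_add] at h1
    have h2 := mul_le_mul_of_nonpos_right (le_max_right ν ((u - v a) / r)) hneg.le
    rw [div_mul_cancel₀ _ hneg.ne] at h2
    linarith
  have hr1 : 0 < 1 + r := by linarith
  -- Adding the contact inequality at `z` to the separating one gives the height the coefficient `1
  -- + r > 0`, so a vertical hyperplane (`r = 0`) needs no separate treatment.
  have key := hE.pairing_le_of_mem_contactSet hz (p := (1 + r)⁻¹ • (z - (a, g)))
    (c := (1 + r)⁻¹ * (dualityProduct z - u)) fun q hq => by
      have h1 := hfE q hq
      have h2 := hz q hq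
      have h3 : pairing ((1 + r)⁻¹ • (z - (a, g))) q.1 =
          (1 + r)⁻¹ * (pairing z q.1 - (g q.1.1 + q.1.2 a)) := by
        simp only [pairing, Prod.smul_fst, Prod.smul_snd, Prod.fst_sub, Prod.snd_sub, sub_apply,
          smul_apply, map_smul, map_sub, smul_eq_mul]
        ring
      rw [h3, sub_le_iff_le_add, ← mul_le_mul_iff_right₀ hr1, mul_add, ← mul_assoc, ← mul_assoc,
        mul_inv_cancel₀ hr1.ne']
      linarith
  have h3 : pairing z ((1 + r)⁻¹ • (z - (a, g))) =
      (1 + r)⁻¹ * (2 * dualityProduct z - (g z.1 + z.2 a)) := by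
    simp only [pairing, dualityProduct, Prod.smul_fst, Prod.smul_snd, Prod.fst_sub, Prod.snd_sub,
      sub_apply, smul_apply, map_smul, map_sub, smul_eq_mul]
    ring
  rw [h3, ← mul_le_mul_iff_right₀ hr1, mul_add, ← mul_assoc, ← mul_assoc,
        mul_inv_cancel₀ hr1.ne'] at key
  linarith

end IsAdmissible

/-! ### From epigraphs back to extended-real functions. -/

/-- Vertical fibres of the closed epigraph are closed and upward closed, so the infimum defining the
closure is attained whenever it is finite. -/
theorem lscClosure_le_iff {Z : Type*} [TopologicalSpace Z] (f : Z → EReal) (z : Z) (μ : ℝ) :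
    lscClosure f z ≤ (μ : EReal) ↔ (z, μ) ∈ closure (epigraph f) := by
  refine ⟨fun h => ?_, fun h => iInf₂_le μ h⟩
  have hup : ∀ ν τ : ℝ, ν ≤ τ → (z, ν) ∈ closure (epigraph f) → (z, τ) ∈ closure (epigraph f) := by
    intro ν τ hντ hν
    have := map_mem_closure (f := fun p : Z × ℝ => (p.1, p.2 + (τ - ν))) (t := epigraph f)
      (by fun_prop) hν fun p hp =>
        le_trans (show f p.1 ≤ (p.2 : EReal) from hp) (EReal.coe_le_coe_iff.2 (by linarith))
    simpa using this
  have hIoi : Ioi μ ⊆ {t | (z, t) ∈ closure (epigraph f)} := by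
    intro t ht
    have h1 : lscClosure f z < (t : EReal) := h.trans_lt (EReal.coe_lt_coe_iff.2 ht)
    simp only [lscClosure, iInf_lt_iff] at h1
    obtain ⟨ν, hν, hlt⟩ := h1
    exact hup ν t (EReal.coe_lt_coe_iff.1 hlt).le hν
  have hcl := closure_minimal hIoi (isClosed_closure.preimage (by fun_prop))
  rw [closure_Ioi] at hcl
  exact hcl self_mem_Ici

variable {h : X × StrongDual ℝ X → EReal}

theorem conjJ_le_iff (hpi : ∀ p, (dualityProduct p : EReal) ≤ h p) (p : X × StrongDual ℝ X)
    (c : ℝ) : conjJ h p ≤ (c : EReal) ↔ ∀ q ∈ epigraph h, pairing p q.1 - q.2 ≤ c := by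
  constructor
  · rintro hle ⟨z, μ⟩ hq
    have h1 := (le_iSup (fun z : X × StrongDual ℝ X => ((ContinuousLinearMap.coprod p.2
      (NormedSpace.inclusionInDoubleDual ℝ X p.1) z : ℝ) : EReal) - h z) z).trans hle
    have h2 := (EReal.sub_le_sub le_rfl hq).trans h1
    exact_mod_cast h2
  · intro hq
    refine iSup_le fun z => ?_
    have h1 := hpi z
    induction hz : h z with
    | bot => simp [hz] at h1
    | top => simp
    | coe μ => exact_mod_cast hq (z, μ) (show h z ≤ (μ : EReal) from hz.le)

theorem conjOperator_eq_contactSet (hpi : ∀ p, (dualityProduct p : EReal) ≤ h p)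
    (hJpi : ∀ p, (dualityProduct p : EReal) ≤ conjJ h p) :
    conjOperator h = contactSet (epigraph h) := by
  ext p
  exact ⟨fun hp => (conjJ_le_iff hpi p _).1 (le_of_eq hp),
    fun hp => le_antisymm ((conjJ_le_iff hpi p _).2 hp) (hJpi p)⟩

theorem fstProj_epigraph : fstProj (epigraph h) = prDomain h := by
  ext x
  constructor
  · rintro ⟨x', μ, hq⟩
    exact ⟨x', lt_of_le_of_lt hq (EReal.coe_lt_top μ)⟩
  · rintro ⟨x', hx⟩
    obtain ⟨μ, hμ, -⟩ := EReal.lt_iff_exists_real_btwn.1 hx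
    exact ⟨x', μ, hμ.le⟩

theorem isAdmissible_epigraph (hconv : IsConvexFun h)
    (hpi : ∀ p, (dualityProduct p : EReal) ≤ h p)
    (hJpi : ∀ p, (dualityProduct p : EReal) ≤ conjJ h p) {L : Submodule ℝ X}
    (hL : IsClosed (L : Set X))
    (hcone : (⋃ (c : ℝ) (_ : 0 < c), c • prDomain h) = (L : Set X)) :
    IsAdmissible (epigraph h) L where
  convex := hconv
  upward := fun q hq μ hμ => le_trans (show h q.1 ≤ _ from hq) (EReal.coe_le_coe_iff.2 hμ)
  dualityProduct_le := fun q hq => EReal.coe_le_coe_iff.1 ((hpi q.1).trans hq)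
  dualityProduct_le_of_conj_le := fun z c hc =>
    EReal.coe_le_coe_iff.1 ((hJpi z).trans ((conjJ_le_iff hpi z c).2 hc))
  isClosed := hL
  fstProj_subset := fun x hx => by
    rw [← SetLike.mem_coe, ← hcone]
    exact mem_iUnion₂.2 ⟨1, one_pos, by rwa [one_smul, ← fstProj_epigraph]⟩
  absorbing := fun x hx => by
    rw [← SetLike.mem_coe, ← hcone] at hx
    obtain ⟨c, hc, hxc⟩ := mem_iUnion₂.1 hx
    refine ⟨c⁻¹, inv_pos.2 hc, ?_⟩
    rw [fstProj_epigraph]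
    exact (mem_smul_set_iff_inv_smul_mem₀ hc.ne' _ _).1 hxc

theorem swLscClosure_le_iff (p : X × StrongDual ℝ X) (μ : ℝ) :
    swLscClosure h p ≤ (μ : EReal) ↔
      ((p.1, StrongDual.toWeakDual p.2), μ) ∈ closure (weakStarSet (epigraph h)) :=
  lscClosure_le_iff _ _ _

theorem isConvexFun_swLscClosure (hconv : IsConvexFun h) : IsConvexFun (swLscClosure h) := by
  intro p hp q hq a b ha hb hab
  exact (swLscClosure_le_iff _ _).2 ((convex_weakStarSet hconv).closure
    ((swLscClosure_le_iff _ _).1 hp) ((swLscClosure_le_iff _ _).1 hq) ha hb hab)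

theorem lowerSemicontinuous_swLscClosure (h : X × StrongDual ℝ X → EReal) :
    LowerSemicontinuous (swLscClosure h) := by
  have hreal : ∀ μ : ℝ, IsClosed (swLscClosure h ⁻¹' Iic (μ : EReal)) := by
    intro μ
    have heq : swLscClosure h ⁻¹' Iic (μ : EReal) =
        (fun p : X × StrongDual ℝ X => ((p.1, StrongDual.toWeakDual p.2), μ)) ⁻¹'
          closure (weakStarSet (epigraph h)) := by
      ext p
      exact swLscClosure_le_iff p μ
    rw [heq]
    refine isClosed_closure.preimage ?_
    have : Continuous fun p : X × StrongDual ℝ X => StrongDual.toWeakDual p.2 :=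
      NormedSpace.Dual.toWeakDual_continuous.comp continuous_snd
    fun_prop
  rw [lowerSemicontinuous_iff_isClosed_preimage]
  intro y
  induction y with
  | bot =>
    have heq : swLscClosure h ⁻¹' Iic ⊥ = ⋂ μ : ℝ, swLscClosure h ⁻¹' Iic (μ : EReal) := by
      ext p
      simp only [mem_preimage, mem_Iic, mem_iInter, le_bot_iff, EReal.eq_bot_iff_forall_lt]
      exact ⟨fun H μ => (H μ).le, fun H μ =>
        (H (μ - 1)).trans_lt (EReal.coe_lt_coe_iff.2 (sub_one_lt μ))⟩
    rw [heq]
    exact isClosed_iInter hreal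
  | top => simp
  | coe μ => exact hreal μ

end FitzpatrickFamily

theorem mainTheorem3 {X : Type*} [NormedAddCommGroup X] [NormedSpace ℝ X] [CompleteSpace X]
    (h : X × StrongDual ℝ X → EReal)
    (hproper : IsProperFun h) (hconv : IsConvexFun h)
    (hpi : ∀ p, (dualityProduct p : EReal) ≤ h p)
    (hJpi : ∀ p, (dualityProduct p : EReal) ≤ conjJ h p)
    (hsub : ∃ L : Submodule ℝ X, IsClosed (L : Set X) ∧
      (⋃ (c : ℝ) (_ : 0 < c), c • prDomain h) = (L : Set X)) :
    IsMaximalMonotoneOp (conjOperator h) ∧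
      swLscClosure h ∈ fitzpatrickFamily (conjOperator h) ∧
      ∀ p, (dualityProduct p : EReal) ≤ swLscClosure h p := by
  obtain ⟨L, hL, hcone⟩ := hsub
  have hE := isAdmissible_epigraph hconv hpi hJpi hL hcone
  have hge : ∀ p, (dualityProduct p : EReal) ≤ swLscClosure h p := fun p =>
    le_iInf₂ fun _ hμ => EReal.coe_le_coe_iff.2 (hE.dualityProduct_le_of_mem_closure hμ)
  rw [conjOperator_eq_contactSet hpi hJpi]
  exact ⟨hE.isMaximalMonotoneOp_contactSet, ⟨isConvexFun_swLscClosure hconv,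
    lowerSemicontinuous_swLscClosure h, hge, fun p hp => le_antisymm
      ((swLscClosure_le_iff _ _).2 (hE.mem_closure_of_mem_contactSet hp)) (hge p)⟩, hge⟩
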